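/- Let $F$ be an algebraically closed field of characteristic zero with infinite transcendence degree over $\mathbb{Q}$, and let $n\geq 1$ be an integer. Let ${\rm O}_n(F)=\{A\in{\rm GL}_n(F) : AA^T={\rm I}_n\}$. Then there exists a field automorphism $\varphi$ of $F$ (which may depend on $n$) such that the automorphism $\varphi_n$ of the group ${\rm O}_n(F)$ given by $\varphi_n((a_{i,j}))=(\varphi(a_{i,j}))$ has Reidemeister number $R(\varphi_n)=2$. Here the Reidemeister number $R(\psi)$ of an automorphism $\psi$ of a group $G$ is the number of equivalence classes of the relation on $G$ under which $x$ and $y$ are equivalent if and only if $x=zy\psi(z)^{-1}$ for some $z\in G$. -/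

import Mathlib

/-- The relation of `φ`-conjugation on a group `G`, for an automorphism `φ` of `G`:
`x` and `y` are `φ`-conjugated if `x = z * y * (φ z)⁻¹` for some `z` in `G`. -/
def twistedConjSetoid {G : Type*} [Group G] (φ : G ≃* G) : Setoid G where
  r x y := ∃ z : G, x = z * y * (φ z)⁻¹
  iseqv :=
    { refl := fun x => ⟨1, by simp⟩
      symm := by
        rintro x y ⟨z, rfl⟩
        exact ⟨z⁻¹, by simp [mul_assoc]⟩
      trans := by
        rintro x y w ⟨z, rfl⟩ ⟨z', rfl⟩
        exact ⟨z * z', by simp [mul_assoc]⟩ }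

/-- The Reidemeister number of an automorphism `φ` of a group `G`: the number of
`φ`-conjugacy classes, where all infinite cardinal numbers are written `⊤`. -/
noncomputable def reidemeisterNumber {G : Type*} [Group G] (φ : G ≃* G) : ℕ∞ :=
  ENat.card (Quotient (twistedConjSetoid φ))

/-- Applying a ring homomorphism to all entries preserves orthogonality of matrices. -/
theorem map_mem_orthogonalGroup {F : Type*} [CommRing F] {n : ℕ} (φ : F →+* F)
    {A : Matrix (Fin n) (Fin n) F} (hA : A ∈ Matrix.orthogonalGroup (Fin n) F) :
    A.map φ ∈ Matrix.orthogonalGroup (Fin n) F := by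
  rw [Matrix.mem_orthogonalGroup_iff] at hA ⊢
  rw [← Matrix.transpose_map, ← Matrix.map_mul, hA]
  exact Matrix.map_one φ (map_zero φ) (map_one φ)

/-- The automorphism of the orthogonal group `O_n(F)` (the `n × n` matrices `A` over `F` with
`A * Aᵀ = 1`) that is induced by an automorphism `φ` of `F`: it applies `φ` to every entry. -/
def orthogonalGroupAut {F : Type*} [CommRing F] (n : ℕ) (φ : F ≃+* F) :
    Matrix.orthogonalGroup (Fin n) F ≃* Matrix.orthogonalGroup (Fin n) F where
  toFun A := ⟨A.1.map φ, map_mem_orthogonalGroup (φ : F →+* F) A.2⟩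
  invFun A := ⟨A.1.map φ.symm, map_mem_orthogonalGroup (φ.symm : F →+* F) A.2⟩
  left_inv A := by
    ext i j
    simp
  right_inv A := by
    ext i j
    simp
  map_mul' A B := Subtype.ext (Matrix.map_mul (f := (φ : F →+* F)))

/-!
Every linear difference system `φ(Z) = A Z` with invertible `A` becomes solvable for a suitable
`φ`: split a transcendence basis of `F` into countably many levels, each with a block of variables
for every column of every system, and let `φ` act by `A` on the blocks of `A` in the levels `m`
for which `A` has entries algebraic over the levels below `m`. Since a level is moved by matrices
over the lower levels, the images again form a transcendence basis. For orthogonal `A` and a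
solution `W` of `A φ(W) = W`, the Gram matrix `Wᵀ W` is fixed by `φ`. Diagonalising it over the
fixed field and dividing by square roots makes `A` `φ`-conjugate to a diagonal matrix of signs. A
pair of signs `-1` is removed by a rotation with entries `p`, `q` such that `φ p = -p` and
`φ q = -q`, and the determinant distinguishes the two remaining classes.
-/

open Matrix
open scoped Cardinal MatrixGroups

section RelAlgClosure

variable {k F : Type*} [Field k] [Field F] [Algebra k F] {S T : Set F} {a : F}

/-- The relative algebraic closure in `F` of the subfield generated over `k` by `S`. It is the
closure of `S` in the matroid of algebraic independence, bundled as an intermediate field. -/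
def relAlgClosure (k : Type*) {F : Type*} [Field k] [Field F] [Algebra k F] (S : Set F) :
    IntermediateField k F :=
  (algebraicClosure (IntermediateField.adjoin k S) F).restrictScalars k

theorem mem_relAlgClosure : a ∈ relAlgClosure k S ↔ IsAlgebraic (Algebra.adjoin k S) a :=
  mem_algebraicClosure_iff.trans IntermediateField.isAlgebraic_adjoin_iff

variable (k S) in
theorem coe_relAlgClosure :
    (relAlgClosure k S : Set F) = (AlgebraicIndependent.matroid k F).closure S := by
  ext a
  rw [AlgebraicIndependent.matroid_closure_eq, SetLike.mem_coe, SetLike.mem_coe,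
    Subalgebra.mem_algebraicClosure, mem_relAlgClosure]

theorem subset_relAlgClosure : S ⊆ relAlgClosure k S := by
  rw [coe_relAlgClosure]
  exact Matroid.subset_closure _ S

theorem relAlgClosure_le_iff : relAlgClosure k S ≤ relAlgClosure k T ↔ S ⊆ relAlgClosure k T := by
  rw [← SetLike.coe_subset_coe, coe_relAlgClosure, coe_relAlgClosure,
    Matroid.closure_subset_closure_iff_subset_closure]

theorem relAlgClosure_mono (h : S ⊆ T) : relAlgClosure k S ≤ relAlgClosure k T :=
  relAlgClosure_le_iff.2 (h.trans subset_relAlgClosure)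

theorem exists_mem_relAlgClosure_of_directed {ι : Type*} [Nonempty ι] {S : ι → Set F}
    (hS : Directed (· ⊆ ·) S) (ha : a ∈ relAlgClosure k (⋃ i, S i)) :
    ∃ i, a ∈ relAlgClosure k (S i) := by
  rw [← SetLike.mem_coe, coe_relAlgClosure] at ha
  obtain ⟨T, hTS, hT, -, haT⟩ := Matroid.exists_mem_finite_closure_of_mem_closure ha
  rw [← coe_relAlgClosure] at haT
  obtain ⟨_, ⟨i, rfl⟩, hTi⟩ := hS.directedOn_range.exists_mem_subset_of_finite_of_subset_sUnion
    (Set.range_nonempty S) hT hTS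
  exact ⟨i, relAlgClosure_mono hTi haT⟩

theorem isTranscendenceBasis_iff_relAlgClosure_eq_top {ι : Type*} {x : ι → F} :
    IsTranscendenceBasis k x ↔
      AlgebraicIndependent k x ∧ relAlgClosure k (Set.range x) = ⊤ := by
  simp only [isTranscendenceBasis_iff_algebraicIndependent_isAlgebraic, Algebra.isAlgebraic_def,
    eq_top_iff, SetLike.le_def, IntermediateField.mem_top, mem_relAlgClosure, true_imp_iff]

theorem algebraicIndependent_relAlgClosure {ι : Type*} {x : ι → F}
    (hx : AlgebraicIndependent (Algebra.adjoin k S) x) :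
    AlgebraicIndependent (relAlgClosure k S) x :=
  (IntermediateField.algebraicIndependent_adjoin_iff.2 hx).algebraicClosure

end RelAlgClosure

section Tower

variable {R A : Type*} [CommRing R] [CommRing A] [Algebra R A]

theorem algebraicIndepOn_union {ι : Type*} {y : ι → A} {s t : Set ι} {E : Subalgebra R A}
    (hs : AlgebraicIndepOn R y s) (hsE : y '' s ⊆ E) (ht : AlgebraicIndepOn E y t)
    (hst : Disjoint s t) : AlgebraicIndepOn R y (s ∪ t) := by
  classical
  have h := hs.sumElim_of_tower (S := E) (by simpa [← Set.image_eq_range] using hsE) ht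
  rw [Set.union_comm]
  refine (algebraicIndependent_equiv' (Equiv.Set.union hst.symm).symm ?_).1 h
  ext (i | i) <;> simp

theorem algebraicIndependent_of_tower {J : Type*} [FaithfulSMul R A] {y : ℕ × J → A}
    {E : ℕ → Subalgebra R A} (hE : Monotone E) (hyE : ∀ m j, y (m, j) ∈ E (m + 1))
    (hy : ∀ m, AlgebraicIndependent (E m) fun j => y (m, j)) : AlgebraicIndependent R y := by
  have hlevel : ∀ m, AlgebraicIndepOn (E m) y {p | p.1 = m} := by
    intro m
    have he : Function.Bijective fun j => (⟨(m, j), rfl⟩ : {p : ℕ × J | p.1 = m}) :=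
      ⟨fun _ _ h => congrArg (fun p => p.1.2) h, fun ⟨(_, j), rfl⟩ => ⟨j, rfl⟩⟩
    exact (algebraicIndependent_equiv (Equiv.ofBijective _ he)).1 (hy m)
  have htrunc : ∀ m, AlgebraicIndepOn R y {p | p.1 < m} := by
    intro m
    induction m with
    | zero =>
      have : IsEmpty {p : ℕ × J | p.1 < 0} := by simp
      exact algebraicIndependent_empty_type_iff.2 (FaithfulSMul.algebraMap_injective R A)
    | succ m ih =>
      have hlow : y '' {p | p.1 < m} ⊆ E m := by
        rintro _ ⟨p, hp, rfl⟩
        exact hE (Nat.succ_le_of_lt hp) (hyE p.1 p.2)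
      have hdisj : Disjoint {p : ℕ × J | p.1 < m} {p | p.1 = m} :=
        Set.disjoint_left.2 fun _ hp => hp.ne
      simpa only [Nat.lt_succ_iff_lt_or_eq, Set.ofPred_or] using
        algebraicIndepOn_union ih hlow (hlevel m) hdisj
  refine algebraicIndependent_of_finite_type fun t ht => ?_
  obtain ⟨m, hm⟩ := (ht.image Prod.fst).bddAbove
  exact (htrunc (m + 1)).mono fun p hp => Nat.lt_succ_of_le (hm ⟨p, hp, rfl⟩)

end Tower

section LowerField

variable {k F J : Type*} [Field k] [Field F] [Algebra k F] {x : ℕ × J → F}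

/-- For a family `x` graded by `ℕ`, the field of all elements that are algebraic over the part of
`x` in degrees less than `m`. -/
def lowerField (k : Type*) {F J : Type*} [Field k] [Field F] [Algebra k F] (x : ℕ × J → F)
    (m : ℕ) : IntermediateField k F :=
  relAlgClosure k (x '' {p | p.1 < m})

variable (k x) in
theorem lowerField_mono : Monotone (lowerField k x) := fun _ _ h =>
  relAlgClosure_mono (Set.image_mono fun _ hp => lt_of_lt_of_le hp h)

theorem mem_lowerField_succ (m : ℕ) (j : J) : x (m, j) ∈ lowerField k x (m + 1) :=
  subset_relAlgClosure ⟨(m, j), m.lt_succ_self, rfl⟩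

theorem exists_mem_lowerField (hx : IsTranscendenceBasis k x) (a : F) :
    ∃ m, a ∈ lowerField k x m := by
  have hunion : ⋃ m, x '' {p | p.1 < m} = Set.range x := by
    rw [← Set.image_iUnion, ← Set.image_univ]
    exact congrArg _ (Set.eq_univ_of_forall fun p => Set.mem_iUnion.2 ⟨p.1 + 1, p.1.lt_succ_self⟩)
  have hmono : Monotone fun m => x '' {p | p.1 < m} := fun _ _ h =>
    Set.image_mono fun _ hp => lt_of_lt_of_le hp h
  refine exists_mem_relAlgClosure_of_directed hmono.directed_le ?_
  rw [hunion, (isTranscendenceBasis_iff_relAlgClosure_eq_top.1 hx).2]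
  exact IntermediateField.mem_top

theorem algebraicIndependent_lowerField (hx : AlgebraicIndependent k x) (m : ℕ) :
    AlgebraicIndependent (lowerField k x m) fun j => x (m, j) := by
  have hdisj : Disjoint {p : ℕ × J | p.1 < m} {p | p.1 = m} :=
    Set.disjoint_left.2 fun _ hp => hp.ne
  exact (algebraicIndependent_relAlgClosure (hx.adjoin_of_disjoint hdisj)).comp
    (fun j => ⟨(m, j), rfl⟩) fun _ _ h => congrArg (fun p => p.1.2) h

theorem isTranscendenceBasis_of_lowerField {y : ℕ × J → F} (hx : IsTranscendenceBasis k x)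
    (hy : ∀ m, AlgebraicIndependent (lowerField k x m) fun j => y (m, j))
    (hyx : ∀ m j, y (m, j) ∈ lowerField k x (m + 1))
    (hxy : ∀ m j, x (m, j) ∈ Submodule.span (lowerField k x m) (Set.range fun j => y (m, j))) :
    IsTranscendenceBasis k y := by
  have hle : ∀ m, lowerField k x m ≤ relAlgClosure k (Set.range y) := by
    intro m
    induction m using Nat.strong_induction_on with
    | _ m ih =>
      refine relAlgClosure_le_iff.2 ?_
      rintro _ ⟨p, hp, rfl⟩
      have hspan : Submodule.span (lowerField k x p.1) (Set.range fun j => y (p.1, j)) ≤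
          (IntermediateField.extendScalars (ih p.1 hp)).toSubalgebra.toSubmodule :=
        Submodule.span_le.2 (Set.range_subset_iff.2 fun j => subset_relAlgClosure ⟨(p.1, j), rfl⟩)
      exact hspan (hxy p.1 p.2)
  refine isTranscendenceBasis_iff_relAlgClosure_eq_top.2
    ⟨algebraicIndependent_of_tower (E := fun m => (lowerField k x m).toSubalgebra)
      (lowerField_mono k x) hyx hy, eq_top_iff.2 fun a _ => ?_⟩
  obtain ⟨m, hm⟩ := exists_mem_lowerField hx a
  exact hle m hm

end LowerField

section BlockMul

variable {ι : Type*} {ν : ι → Type*} [∀ c, Fintype (ν c)]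

/-- The action of a family of square matrices on a family of vectors of the same sizes, the vectors
being concatenated into one family of elements of an `R`-module. -/
def blockMul {R A : Type*} [Semiring R] [AddCommMonoid A] [Module R A]
    (B : ∀ c, Matrix (ν c) (ν c) R) (x : (Σ c, ν c) → A) : (Σ c, ν c) → A :=
  fun p => ∑ l, B p.1 p.2 l • x ⟨p.1, l⟩

theorem blockMul_blockMul {R A : Type*} [Semiring R] [AddCommMonoid A] [Module R A]
    (B C : ∀ c, Matrix (ν c) (ν c) R) (x : (Σ c, ν c) → A) :
    blockMul B (blockMul C x) = blockMul (B * C) x := by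
  ext p
  simp only [blockMul, Pi.mul_apply, mul_apply, Finset.smul_sum, Finset.sum_smul, mul_smul]
  rw [Finset.sum_comm]

theorem one_blockMul {R A : Type*} [Semiring R] [AddCommMonoid A] [Module R A]
    [∀ c, DecidableEq (ν c)] (x : (Σ c, ν c) → A) :
    blockMul (1 : ∀ c, Matrix (ν c) (ν c) R) x = x := by
  ext p
  simp [blockMul, one_apply]

open MvPolynomial in
theorem aeval_blockMul {R A : Type*} [CommRing R] [CommRing A] [Algebra R A]
    (B : ∀ c, Matrix (ν c) (ν c) R) (x : (Σ c, ν c) → A) :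
    aeval (blockMul B x) = (aeval x).comp (aeval (R := R) (blockMul B X)) := by
  ext p
  simp [blockMul]

open MvPolynomial in
theorem algebraicIndependent_blockMul {R A : Type*} [CommRing R] [CommRing A] [Algebra R A]
    [∀ c, DecidableEq (ν c)] {x : (Σ c, ν c) → A} (hx : AlgebraicIndependent R x)
    {B C : ∀ c, Matrix (ν c) (ν c) R} (hBC : B * C = 1) :
    AlgebraicIndependent R (blockMul B x) := by
  have hinv : (aeval (R := R) (blockMul C X)).comp (aeval (blockMul B X)) =
      AlgHom.id R (MvPolynomial (Σ c, ν c) R) := by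
    rw [← aeval_blockMul, blockMul_blockMul, hBC, one_blockMul, aeval_X_left]
  have hinj : Function.Injective (aeval (R := R) (blockMul B (X (R := R)))) := by
    refine Function.Injective.of_comp (f := aeval (R := R) (blockMul C (X (R := R)))) ?_
    rw [← AlgHom.coe_comp, hinv]
    exact Function.injective_id
  rw [AlgebraicIndependent, aeval_blockMul]
  exact Function.Injective.comp (g := aeval x) hx hinj

end BlockMul

section Cardinality

open Cardinal

universe u v

theorem mk_sigma_le_of_aleph0_le {ι : Type v} {f : ι → Type u} {κ : Cardinal.{max u v}}
    (hκ : ℵ₀ ≤ κ) (hι : lift.{u} #ι ≤ κ) (hf : ∀ i, lift.{v} #(f i) ≤ κ) :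
    #(Σ i, f i) ≤ κ := by
  rw [mk_sigma]
  exact (sum_le_lift_mk_mul_iSup_lift _).trans (mul_le_of_le hκ hι (ciSup_le' hf))

theorem mk_generalLinearGroup_le (K : Type*) [CommRing K] [Infinite K] (n : ℕ) :
    #(GL (Fin n) K) ≤ #K := by
  have hK := aleph0_le_mk K
  calc #(GL (Fin n) K) ≤ #(Matrix (Fin n) (Fin n) K) := mk_le_of_injective Units.val_injective
    _ = (#K ^ n) ^ n := by simp [Matrix]
    _ ≤ #K := (power_le_power_right (power_nat_le hK)).trans (power_nat_le hK)

theorem trdeg_eq_mk (k : Type v) (F : Type u) [Field k] [Countable k] [Field F] [Algebra k F]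
    [IsAlgClosed F] (hF : ℵ₀ ≤ Algebra.trdeg k F) : Algebra.trdeg k F = #F := by
  obtain ⟨ι, x, hx⟩ := exists_isTranscendenceBasis' k F
  rw [← hx.cardinalMk_eq_trdeg] at hF ⊢
  refine (mk_le_of_injective hx.1.injective).antisymm (lift_le.{max v u}.1 ?_)
  have hk : lift.{u} #k ≤ lift.{max v u} #ι :=
    (lift_le_aleph0.2 mk_le_aleph0).trans (aleph0_le_lift.2 hF)
  have h := IsAlgClosed.cardinal_le_max_transcendence_basis x hx
  simpa only [max_eq_right hk, max_eq_left (aleph0_le_lift.2 hF)] using h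

/-- The columns of the unknown matrices of all linear difference systems `φ(Z) = A Z` over `K` with
invertible `A`: a size `n`, the matrix `A` and the number of a column. Each of them gets its own
blocks of `n` transcendence basis elements. -/
abbrev ColumnIndex (K : Type*) [CommRing K] : Type _ := Σ n, GL (Fin n) K × Fin n

theorem mk_columnIndex (K : Type*) [CommRing K] [Infinite K] :
    #(ℕ × Σ c : ColumnIndex K, Fin c.1) = #K := by
  have hK := aleph0_le_mk K
  have hnat : ∀ n : ℕ, (n : Cardinal) ≤ #K := fun n => natCast_lt_aleph0.le.trans hK
  have hsystem : ∀ n, #(GL (Fin n) K × Fin n) ≤ #K := fun n => by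
    simpa using mul_le_of_le hK (mk_generalLinearGroup_le K n) (hnat n)
  have hcolumn : #(ColumnIndex K) ≤ #K :=
    mk_sigma_le_of_aleph0_le hK (by simp) (by simpa using hsystem)
  have hentry : #(Σ c : ColumnIndex K, Fin c.1) ≤ #K :=
    mk_sigma_le_of_aleph0_le hK (by rwa [lift_uzero]) fun c => by simpa using hnat c.1
  refine le_antisymm ?_ (mk_le_of_injective (f := fun a =>
    (0, ⟨⟨2, GeneralLinearGroup.upperRightHom a, 0⟩, (0 : Fin 2)⟩)) fun a b h => ?_)
  · rw [mk_prod, mk_nat, lift_aleph0, lift_uzero]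
    exact mul_le_of_le hK hK hentry
  · exact GeneralLinearGroup.injective_upperRightHom (by simpa using h)

theorem exists_isTranscendenceBasis_columnIndex {k F : Type*} [Field k] [Countable k] [Field F]
    [Algebra k F] [IsAlgClosed F] (hF : ℵ₀ ≤ Algebra.trdeg k F) :
    ∃ x : ℕ × (Σ c : ColumnIndex F, Fin c.1) → F, IsTranscendenceBasis k x := by
  obtain ⟨ι, x, hx⟩ := exists_isTranscendenceBasis' k F
  have : Infinite F := infinite_iff.2 (hF.trans_eq (trdeg_eq_mk k F hF))
  obtain ⟨e⟩ := Cardinal.eq.1 <| calc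
    #(ℕ × Σ c : ColumnIndex F, Fin c.1) = #F := mk_columnIndex F
    _ = Algebra.trdeg k F := (trdeg_eq_mk k F hF).symm
    _ = #ι := hx.cardinalMk_eq_trdeg.symm
  exact ⟨x ∘ e, hx.comp_equiv e⟩

end Cardinality

section Automorphism

variable {k F : Type*} [Field k] [Field F] [Algebra k F]

theorem exists_algEquiv_of_isTranscendenceBasis {ι : Type*} [IsAlgClosed F] {x y : ι → F}
    (hx : IsTranscendenceBasis k x) (hy : IsTranscendenceBasis k y) :
    ∃ φ : F ≃ₐ[k] F, ∀ i, φ (x i) = y i := by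
  have := IsAlgClosed.isAlgClosure_of_transcendence_basis x hx
  have := IsAlgClosed.isAlgClosure_of_transcendence_basis y hy
  let e : Algebra.adjoin k (Set.range x) ≃ₐ[k] Algebra.adjoin k (Set.range y) :=
    hx.1.aevalEquiv.symm.trans hy.1.aevalEquiv
  let φ : F ≃+* F := IsAlgClosure.equivOfEquiv F F e.toRingEquiv
  have hφ : ∀ a : Algebra.adjoin k (Set.range x), φ a = e a :=
    IsAlgClosure.equivOfEquiv_algebraMap F F e.toRingEquiv
  refine ⟨AlgEquiv.ofRingEquiv (f := φ) fun r => ?_, fun i => ?_⟩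
  · have h := hφ (algebraMap k _ r)
    rwa [e.commutes] at h
  · simpa [e] using hφ (hx.1.aevalEquiv (MvPolynomial.X i))

variable {ι : Type*} {ν : ι → Type*} [∀ c, Fintype (ν c)] [∀ c, DecidableEq (ν c)]
  {x : ℕ × (Σ c, ν c) → F}

theorem isTranscendenceBasis_blockMul (hx : IsTranscendenceBasis k x)
    {B C : ∀ m c, Matrix (ν c) (ν c) (lowerField k x m)} (hBC : ∀ m, B m * C m = 1)
    (hCB : ∀ m, C m * B m = 1) :
    IsTranscendenceBasis k fun p : ℕ × (Σ c, ν c) =>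
      blockMul (B p.1) (fun q => x (p.1, q)) p.2 := by
  refine isTranscendenceBasis_of_lowerField hx (fun m => ?_) (fun m p => ?_) fun m p => ?_
  · change AlgebraicIndependent (lowerField k x m) (blockMul (B m) fun q => x (m, q))
    exact algebraicIndependent_blockMul (algebraicIndependent_lowerField hx.1 m) (hBC m)
  · refine sum_mem fun l _ => ?_
    exact mul_mem (lowerField_mono k x m.le_succ (B m p.1 p.2 l).2) (mem_lowerField_succ m _)
  · have hp : x (m, p) = blockMul (C m) (blockMul (B m) fun q => x (m, q)) p := by
      rw [blockMul_blockMul, hCB, one_blockMul]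
    rw [hp]
    exact sum_mem fun l _ => Submodule.smul_mem _ _ (Submodule.subset_span ⟨⟨p.1, l⟩, rfl⟩)

theorem exists_algEquiv_apply_eq_blockMul [IsAlgClosed F] (hx : IsTranscendenceBasis k x)
    (B : ∀ m c, GL (ν c) (lowerField k x m)) :
    ∃ φ : F ≃ₐ[k] F, ∀ m p,
      φ (x (m, p)) = blockMul (fun c => (B m c).1) (fun q => x (m, q)) p := by
  obtain ⟨φ, hφ⟩ := exists_algEquiv_of_isTranscendenceBasis hx <|
    isTranscendenceBasis_blockMul hx (B := fun m c => (B m c).1) (C := fun m c => (B m c)⁻¹.1)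
      (fun m => funext fun c => (B m c).mul_inv) fun m => funext fun c => (B m c).inv_mul
  exact ⟨φ, fun m p => hφ (m, p)⟩

theorem exists_map_lowerField_eq {J n : Type*} [Fintype n] [DecidableEq n] {x : ℕ × J → F}
    (hx : IsTranscendenceBasis k x) (A : GL n F) :
    ∃ m, ∃ B : GL n (lowerField k x m),
      GeneralLinearGroup.map (algebraMap (lowerField k x m) F) B = A := by
  choose d hd using exists_mem_lowerField hx
  obtain ⟨m, hm⟩ := (Set.finite_range fun p : n × n => d (A p.1 p.2)).bddAbove
  have hA : ∀ i j, A i j ∈ lowerField k x m := fun i j =>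
    lowerField_mono k x (hm ⟨(i, j), rfl⟩) (hd _)
  let B : Matrix n n (lowerField k x m) := of fun i j => ⟨A i j, hA i j⟩
  have hB : (algebraMap (lowerField k x m) F).mapMatrix B = A.1 := rfl
  have hdet : B.det ≠ 0 := by
    intro h
    have hdetA : A.1.det = 0 := by rw [← hB, ← RingHom.map_det, h, map_zero]
    exact A.det.ne_zero hdetA
  exact ⟨m, .mkOfDetNeZero B hdet, Units.ext hB⟩

theorem exists_algEquiv_map_column_eq [IsAlgClosed F] (hx : IsTranscendenceBasis k x)
    (A : ∀ c, GL (ν c) F) :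
    ∃ φ : F ≃ₐ[k] F, ∀ c, ∃ m, ∀ i, φ (x (m, ⟨c, i⟩)) = ∑ l, A c i l * x (m, ⟨c, l⟩) := by
  -- In the levels over which `A c` is not defined, `invFun` gives an irrelevant junk matrix.
  let f := fun m c => GeneralLinearGroup.map (n := ν c) (algebraMap (lowerField k x m) F)
  obtain ⟨φ, hφ⟩ := exists_algEquiv_apply_eq_blockMul hx fun m c => Function.invFun (f m c) (A c)
  refine ⟨φ, fun c => ?_⟩
  obtain ⟨m, hm⟩ := exists_map_lowerField_eq hx (A c)
  have hA := Function.invFun_eq hm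
  refine ⟨m, fun i => (hφ m ⟨c, i⟩).trans (Finset.sum_congr rfl fun l _ => ?_)⟩
  rw [← hA]
  rfl

theorem det_of_ne_zero_of_algebraicIndependent {R A n : Type*} [CommRing R] [Nontrivial R]
    [CommRing A] [Algebra R A] [Fintype n] [DecidableEq n] {z : n × n → A}
    (hz : AlgebraicIndependent R z) : (of fun i j => z (i, j)).det ≠ 0 := by
  have hmap : (of fun i j => z (i, j)) =
      (MvPolynomial.aeval z).mapMatrix (mvPolynomialX n n R) := by
    ext i j
    simp
  rw [hmap, ← AlgHom.map_det, map_ne_zero_iff _ hz]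
  exact det_mvPolynomialX_ne_zero n R

/-- An automorphism `φ` for which every linear difference system `φ(Z) = A Z` with invertible `A`
has an invertible solution, as over a linearly closed difference field. -/
def IsLinearlyDifferenceClosed {F : Type*} [Field F] (φ : F ≃+* F) : Prop :=
  ∀ (n : ℕ) (A : GL (Fin n) F), ∃ Z : GL (Fin n) F,
    GeneralLinearGroup.map (φ : F →+* F) Z = A * Z

theorem exists_algEquiv_isLinearlyDifferenceClosed [Countable k] [IsAlgClosed F]
    (hF : ℵ₀ ≤ Algebra.trdeg k F) :
    ∃ φ : F ≃ₐ[k] F, IsLinearlyDifferenceClosed (φ : F ≃+* F) := by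
  obtain ⟨x, hx⟩ := exists_isTranscendenceBasis_columnIndex hF
  obtain ⟨φ, hφ⟩ := exists_algEquiv_map_column_eq hx fun c => c.2.1
  refine ⟨φ, fun n A => ?_⟩
  choose m hm using fun j => hφ ⟨n, A, j⟩
  let z : Fin n × Fin n → F := fun p => x (m p.2, ⟨⟨n, A, p.2⟩, p.1⟩)
  have hz : AlgebraicIndependent k z := hx.1.comp _ fun p q h => by
    ext <;> simp_all
  refine ⟨.mkOfDetNeZero _ (det_of_ne_zero_of_algebraicIndependent hz), ?_⟩
  ext i j
  exact hm j i

theorem exists_isLinearlyDifferenceClosed [Countable k] [IsAlgClosed F]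
    (hF : ℵ₀ ≤ Algebra.trdeg k F) :
    ∃ φ : F ≃+* F, IsLinearlyDifferenceClosed φ ∧ ∀ a, IsAlgebraic k a → φ a = a := by
  have : Countable (algebraicClosure k F) := by
    have hcount : {a : F | IsAlgebraic k a}.Countable := Algebraic.countable k F
    exact (hcount.mono fun a ha => mem_algebraicClosure_iff.1 ha).to_subtype
  obtain ⟨ι, x, hx⟩ := exists_isTranscendenceBasis' k F
  have hx' : IsTranscendenceBasis (algebraicClosure k F) x :=
    (Algebra.IsAlgebraic.isTranscendenceBasis_iff k (algebraicClosure k F)).1 hx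
  have hF' : ℵ₀ ≤ Algebra.trdeg (algebraicClosure k F) F := by
    rwa [← hx'.cardinalMk_eq_trdeg, hx.cardinalMk_eq_trdeg]
  obtain ⟨φ, hφ⟩ := exists_algEquiv_isLinearlyDifferenceClosed hF'
  exact ⟨φ, hφ, fun a ha => φ.commutes ⟨a, mem_algebraicClosure_iff.2 ha⟩⟩

end Automorphism

section Diagonalization

theorem exists_transpose_mul_mul_eq_diagonal {K ι : Type*} [Field K] [NeZero (2 : K)] [Fintype ι]
    [DecidableEq ι] {S : Matrix ι ι K} (hS : S.IsSymm) :
    ∃ (P : GL ι K) (d : ι → K), P.1ᵀ * S * P.1 = diagonal d := by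
  have : Invertible (2 : K) := invertibleOfNonzero two_ne_zero
  have hB : LinearMap.IsSymm S.toBilin' := ⟨(isSymm_toBilin'_iff_isSymm.2 hS).eq⟩
  obtain ⟨v, hv⟩ := LinearMap.BilinForm.exists_orthogonal_basis hB
  let b := Pi.basisFun K ι
  let w := v.reindex (Fintype.equivFinOfCardEq (Module.finrank_fintype_fun_eq_card K).symm).symm
  refine ⟨⟨b.toMatrix w, w.toMatrix b, b.toMatrix_mul_toMatrix_flip w,
    w.toMatrix_mul_toMatrix_flip b⟩, fun i => S.toBilin' (w i) (w i), ?_⟩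
  have hS' : LinearMap.BilinForm.toMatrix b S.toBilin' = S := by
    rw [LinearMap.BilinForm.toMatrix_basisFun, LinearMap.BilinForm.toMatrix'_toBilin']
  nth_rw 1 [← hS']
  rw [LinearMap.BilinForm.toMatrix_mul_basis_toMatrix]
  ext i j
  rw [LinearMap.BilinForm.toMatrix_apply, diagonal_apply]
  split_ifs with hij
  · rw [hij]
  · simpa [w] using hv ((Equiv.injective _).ne hij)

theorem exists_transpose_mul_self_eq_diagonal {F ι κ : Type*} [Field F] [NeZero (2 : F)] [Fintype ι]
    [Fintype κ] [DecidableEq κ] {σ : F →+* F} {W : Matrix ι κ F}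
    (hW : (Wᵀ * W).map σ = Wᵀ * W) :
    ∃ (P : GL κ F) (d : κ → F), P.1.map σ = P.1 ∧ (W * P.1)ᵀ * (W * P.1) = diagonal d := by
  let K : Subfield F := σ.eqLocusField (RingHom.id F)
  let S : Matrix κ κ K := of fun i j => ⟨(Wᵀ * W) i j, congrFun₂ hW i j⟩
  have hSW : S.map K.subtype = Wᵀ * W := rfl
  have hS : S.IsSymm := by
    refine map_injective K.subtype_injective ?_
    dsimp only
    rw [transpose_map, hSW, transpose_mul, transpose_transpose]
  have : NeZero (2 : K) := ⟨fun h => two_ne_zero (congrArg K.subtype h)⟩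
  obtain ⟨P, d, hP⟩ := exists_transpose_mul_mul_eq_diagonal hS
  refine ⟨GeneralLinearGroup.map K.subtype P, K.subtype ∘ d, ?_, ?_⟩
  · ext i j
    exact (P.1 i j).2
  · have h := congrArg (fun M => M.map K.subtype) hP
    simp only [Matrix.map_mul, transpose_map, hSW, diagonal_map (map_zero _)] at h
    rwa [transpose_mul, ← Matrix.mul_assoc, Matrix.mul_assoc _ Wᵀ]

end Diagonalization

section SignedFrame

/-- The semilinear map `v ↦ A (σ v)`, where `σ` is applied to the coordinates of `v`. -/
def semilinearMulVec {R ι : Type*} [CommSemiring R] [Fintype ι] (σ : R →+* R) (A : Matrix ι ι R) :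
    (ι → R) →ₛₗ[σ] ι → R where
  toFun v := A *ᵥ (σ ∘ v)
  map_add' v w := by
    rw [← mulVec_add]
    congr 1
    ext i
    simp
  map_smul' a v := by
    rw [← mulVec_smul]
    congr 1
    ext i
    simp

/-- The family `z` with the vectors `z i` and `z j` rotated in the plane they span, by the matrix
with rows `(p, q)` and `(-q, p)`; this matrix is orthogonal when `p² + q² = 1`. -/
def rotatePair {R ι κ : Type*} [Ring R] [DecidableEq κ] (p q : R) (i j : κ) (z : κ → ι → R) :
    κ → ι → R :=
  fun a => if a = i then p • z i + q • z j else if a = j then p • z j - q • z i else z a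

theorem rotatePair_dotProduct_rotatePair {R ι κ : Type*} [CommRing R] [Fintype ι] [DecidableEq κ]
    {z : κ → ι → R} (hz : ∀ a b, z a ⬝ᵥ z b = if a = b then 1 else 0) {p q : R}
    (hpq : p * p + q * q = 1) {i j : κ} (hij : i ≠ j) (a b : κ) :
    rotatePair p q i j z a ⬝ᵥ rotatePair p q i j z b = if a = b then 1 else 0 := by
  have : q * q + p * p = 1 := by rw [add_comm, hpq]
  have := hij.symm
  unfold rotatePair
  by_cases hai : a = i <;> by_cases haj : a = j <;> by_cases hbi : b = i <;>
    by_cases hbj : b = j <;> simp_all [mul_comm, eq_comm]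

/-- An orthonormal family `z` of vectors on which the semilinear map `T` acts by signs, the sign
being `-1` exactly on the vectors with index in `s`. -/
structure IsSignedFrame {R ι κ : Type*} [CommRing R] [Fintype ι] [DecidableEq κ] {σ : R →+* R}
    (T : (ι → R) →ₛₗ[σ] ι → R) (s : Finset κ) (z : κ → ι → R) : Prop where
  dotProduct_eq : ∀ i j, z i ⬝ᵥ z j = if i = j then 1 else 0
  map_eq : ∀ i, T (z i) = if i ∈ s then -z i else z i

namespace IsSignedFrame

variable {R ι κ : Type*} [CommRing R] [Fintype ι] [DecidableEq κ] {σ : R →+* R}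
  {T : (ι → R) →ₛₗ[σ] ι → R} {s : Finset κ} {z : κ → ι → R}

theorem comp_equiv {κ' : Type*} [DecidableEq κ'] (hz : IsSignedFrame T s z) (e : κ' ≃ κ) :
    IsSignedFrame T (s.map e.symm.toEmbedding) (z ∘ e) where
  dotProduct_eq i j := by simp [hz.dotProduct_eq]
  map_eq i := by simp [hz.map_eq]

theorem singleton_swap {i : κ} (hz : IsSignedFrame T {i} z) (j : κ) :
    IsSignedFrame T {j} (z ∘ Equiv.swap i j) := by
  simpa using hz.comp_equiv (Equiv.swap i j)

theorem erase_pair (hz : IsSignedFrame T s z) {p q : R} (hpq : p * p + q * q = 1)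
    (hp : σ p = -p) (hq : σ q = -q) {i j : κ} (hij : i ≠ j) (hi : i ∈ s) (hj : j ∈ s) :
    IsSignedFrame T ((s.erase i).erase j) (rotatePair p q i j z) where
  dotProduct_eq := rotatePair_dotProduct_rotatePair hz.dotProduct_eq hpq hij
  map_eq a := by
    have hTi : T (z i) = -z i := by rw [hz.map_eq, if_pos hi]
    have hTj : T (z j) = -z j := by rw [hz.map_eq, if_pos hj]
    by_cases hai : a = i
    · simp [rotatePair, hai, hTi, hTj, hp, hq]
    · by_cases haj : a = j
      · simp [rotatePair, haj, hij.symm, hTi, hTj, hp, hq]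
      · simp [rotatePair, hai, haj, hz.map_eq a]

theorem exists_card_le_one (hz : IsSignedFrame T s z) {p q : R} (hpq : p * p + q * q = 1)
    (hp : σ p = -p) (hq : σ q = -q) :
    ∃ (s' : Finset κ) (z' : κ → ι → R), IsSignedFrame T s' z' ∧ s'.card ≤ 1 := by
  induction hs : s.card using Nat.strong_induction_on generalizing s z with
  | _ m ih =>
    by_cases h : s.card ≤ 1
    · exact ⟨s, z, hz, h⟩
    · obtain ⟨i, hi, j, hj, hij⟩ := Finset.one_lt_card.1 (not_le.1 h)
      have hz' := hz.erase_pair hpq hp hq hij hi hj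
      have hlt : ((s.erase i).erase j).card < s.card :=
        Finset.card_erase_le.trans_lt (Finset.card_erase_lt_of_mem hi)
      exact ih _ (hlt.trans_eq hs) hz' rfl

end IsSignedFrame

theorem exists_mul_self_mul_eq_one {F : Type*} [Field F] [IsAlgClosed F] (σ : F →+* F) {a : F}
    (ha : a ≠ 0) (hσ : σ a = a) : ∃ r, r * r * a = 1 ∧ (σ r = r ∨ σ r = -r) := by
  obtain ⟨r, hr⟩ := IsAlgClosed.exists_eq_mul_self a⁻¹
  refine ⟨r, by rw [← hr, inv_mul_cancel₀ ha], ?_⟩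
  rw [← mul_self_eq_mul_self_iff, ← map_mul, ← hr, map_inv₀, hσ]

theorem map_transpose_mul_self {R ι κ : Type*} [CommRing R] [Fintype ι] [DecidableEq ι]
    {σ : R →+* R} {A : Matrix ι ι R} (hA : A ∈ orthogonalGroup ι R) {W : Matrix ι κ R}
    (hW : A * W.map σ = W) : (Wᵀ * W).map σ = Wᵀ * W :=
  calc (Wᵀ * W).map σ = (W.map σ)ᵀ * (Aᵀ * A) * W.map σ := by
        rw [(mem_orthogonalGroup_iff' _ _).1 hA, Matrix.mul_one, Matrix.map_mul, transpose_map]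
    _ = (A * W.map σ)ᵀ * (A * W.map σ) := by simp only [transpose_mul, Matrix.mul_assoc]
    _ = Wᵀ * W := by rw [hW]

theorem exists_transpose_mul_self_eq_diagonal_of_mul_map_eq {F ι : Type*} [Field F]
    [NeZero (2 : F)] [Fintype ι] [DecidableEq ι] {σ : F →+* F} {A : Matrix ι ι F}
    (hA : A ∈ orthogonalGroup ι F) {W : GL ι F} (hW : A * W.1.map σ = W.1) :
    ∃ (V : GL ι F) (d : ι → F), A * V.1.map σ = V.1 ∧ V.1ᵀ * V.1 = diagonal d ∧
      ∀ i, d i ≠ 0 ∧ σ (d i) = d i := by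
  obtain ⟨P, d, hP, hd⟩ := exists_transpose_mul_self_eq_diagonal (map_transpose_mul_self hA hW)
  have hV : A * (W * P).1.map σ = (W * P).1 := by
    rw [Units.val_mul, Matrix.map_mul, hP, ← Matrix.mul_assoc, hW]
  rw [← Units.val_mul] at hd
  refine ⟨W * P, d, hV, hd, fun i => ⟨fun hi => ?_, ?_⟩⟩
  · have hdet := congrArg det hd
    rw [det_mul, det_transpose, det_diagonal, Finset.prod_eq_zero (Finset.mem_univ i) hi] at hdet
    exact mul_self_ne_zero.2 (W * P).det.ne_zero hdet
  · have h := congrFun₂ (map_transpose_mul_self hA hV) i i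
    rwa [hd, map_apply, diagonal_apply_eq] at h

theorem exists_isSignedFrame {F ι : Type*} [Field F] [IsAlgClosed F] [NeZero (2 : F)] [Fintype ι]
    [DecidableEq ι] {σ : F →+* F} {A : Matrix ι ι F} (hA : A ∈ orthogonalGroup ι F) {W : GL ι F}
    (hW : A * W.1.map σ = W.1) :
    ∃ (s : Finset ι) (z : ι → ι → F), IsSignedFrame (semilinearMulVec σ A) s z := by
  obtain ⟨V, d, hV, hVV, hd⟩ := exists_transpose_mul_self_eq_diagonal_of_mul_map_eq hA hW
  choose r hr hσr using fun i => exists_mul_self_mul_eq_one σ (hd i).1 (hd i).2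
  have hfix : ∀ i, semilinearMulVec σ A (V.1.col i) = V.1.col i := fun i =>
    funext fun j => congrFun₂ hV j i
  classical
  refine ⟨Finset.univ.filter fun i => σ (r i) = -r i, fun i => r i • V.1.col i,
    fun i j => ?_, fun i => ?_⟩
  · have hdot : V.1.col i ⬝ᵥ V.1.col j = diagonal d i j := congrFun₂ hVV i j
    rw [smul_dotProduct, dotProduct_smul, hdot, smul_eq_mul, smul_eq_mul, ← mul_assoc,
      diagonal_apply]
    split_ifs with hij
    · rw [← hij, hr]
    · rw [mul_zero]
  · rw [map_smulₛₗ, hfix]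
    simp only [Finset.mem_filter, Finset.mem_univ, true_and]
    split_ifs with hi
    · rw [hi, neg_smul]
    · rw [(hσr i).resolve_right hi]

end SignedFrame

section TwistedConj

theorem reidemeisterNumber_eq_two {G : Type*} [Group G] {ψ : G ≃* G} {a b : G}
    (hab : ¬ twistedConjSetoid ψ a b)
    (h : ∀ x, twistedConjSetoid ψ x a ∨ twistedConjSetoid ψ x b) : reidemeisterNumber ψ = 2 := by
  have hcard : Nat.card (Quotient (twistedConjSetoid ψ)) = 2 := by
    refine Nat.card_eq_two_iff.2 ⟨⟦a⟧, ⟦b⟧, fun h => hab (Quotient.exact h), ?_⟩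
    refine Set.eq_univ_of_forall (Quotient.ind fun x => ?_)
    exact (h x).imp (fun h => Quotient.sound h) fun h => Quotient.sound h
  have : Finite (Quotient (twistedConjSetoid ψ)) := Nat.finite_of_card_ne_zero (by simp [hcard])
  rw [reidemeisterNumber, ENat.card_eq_coe_natCard, hcard, Nat.cast_ofNat]

/-- The diagonal orthogonal matrix with entries `-1` exactly at the indices in `s`. -/
def signDiagonal (R : Type*) {ι : Type*} [CommRing R] [Fintype ι] [DecidableEq ι] (s : Finset ι) :
    orthogonalGroup ι R :=
  ⟨diagonal fun i => if i ∈ s then -1 else 1, by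
    rw [mem_orthogonalGroup_iff, diagonal_transpose, diagonal_mul_diagonal, ← diagonal_one]
    congr 1
    ext i
    split_ifs <;> simp⟩

theorem det_signDiagonal (R : Type*) {ι : Type*} [CommRing R] [Fintype ι] [DecidableEq ι]
    (s : Finset ι) : (signDiagonal R s).1.det = (-1) ^ s.card := by
  simp [signDiagonal]

theorem det_eq_of_twistedConj {R : Type*} [CommRing R] [IsDomain R] {n : ℕ} {φ : R ≃+* R}
    {A B : orthogonalGroup (Fin n) R} (h : twistedConjSetoid (orthogonalGroupAut n φ) A B) :
    A.1.det = B.1.det := by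
  obtain ⟨Z, hZ⟩ := h
  rw [eq_mul_inv_iff_mul_eq] at hZ
  have hφZ : (orthogonalGroupAut n φ Z).1.det = φ Z.1.det :=
    (RingHom.map_det (φ : R →+* R) Z.1).symm
  have hAB : A.1.det * φ Z.1.det = Z.1.det * B.1.det := by
    rw [← hφZ, ← det_mul, ← det_mul]
    exact congrArg (fun M => M.1.det) hZ
  have hdet : Z.1.det * Z.1.det = 1 := by
    have h := congrArg det ((mem_orthogonalGroup_iff _ _).1 Z.2)
    rwa [det_mul, det_transpose, det_one] at h
  rcases mul_self_eq_one_iff.1 hdet with h | h <;> simpa [h] using hAB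

theorem IsSignedFrame.twistedConj {R : Type*} [CommRing R] {n : ℕ} {φ : R ≃+* R}
    {A : orthogonalGroup (Fin n) R} {s : Finset (Fin n)} {z : Fin n → Fin n → R}
    (hz : IsSignedFrame (semilinearMulVec (φ : R →+* R) A.1) s z) :
    twistedConjSetoid (orthogonalGroupAut n φ) A (signDiagonal R s) := by
  let Z : orthogonalGroup (Fin n) R := ⟨(of z)ᵀ, by
    rw [mem_orthogonalGroup_iff']
    ext i j
    exact (hz.dotProduct_eq i j).trans (one_apply).symm⟩
  refine ⟨Z, eq_mul_inv_iff_mul_eq.2 (Subtype.ext ?_)⟩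
  ext i j
  have hcol : (A.1 * (orthogonalGroupAut n φ Z).1) i j =
      (if j ∈ s then -z j else z j) i := congrFun (hz.map_eq j) i
  have hdiag : (Z.1 * (signDiagonal R s).1) i j = z j i * if j ∈ s then -1 else 1 :=
    mul_diagonal _ _ i j
  refine hcol.trans (Eq.trans ?_ hdiag.symm)
  split_ifs <;> simp

end TwistedConj

section LinearlyDifferenceClosed

variable {F : Type*} [Field F] {φ : F ≃+* F}

theorem IsLinearlyDifferenceClosed.exists_map_eq_neg (hφ : IsLinearlyDifferenceClosed φ) :
    ∃ u, u ≠ 0 ∧ φ u = -u := by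
  obtain ⟨Z, hZ⟩ := hφ 1 (-1)
  refine ⟨Z.1.det, Z.det.ne_zero, ?_⟩
  have h := congrArg (fun M => M.1 0 0) hZ
  simpa [det_fin_one] using h

theorem exists_mul_self_add_mul_self_eq_one_of_map_eq_neg [NeZero (2 : F)] {σ : F →+* F} {u I : F}
    (hu : u ≠ 0) (hσu : σ u = -u) (hI : I * I = -1) (hσI : σ I = I) :
    ∃ p q, p * p + q * q = 1 ∧ σ p = -p ∧ σ q = -q := by
  have h2 : (2 : F) ≠ 0 := two_ne_zero
  -- `p = cos θ` and `q = sin θ` for the formal angle `θ` with `u = exp (I θ)`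
  refine ⟨(u⁻¹ + u) / 2, I * (u⁻¹ - u) / 2, ?_, ?_, ?_⟩
  · field_simp
    linear_combination (1 - u ^ 2) ^ 2 * hI
  · simp only [map_div₀, map_add, map_inv₀, hσu, map_ofNat, inv_neg]
    ring
  · simp only [map_div₀, map_mul, map_sub, map_inv₀, hσu, hσI, map_ofNat, inv_neg]
    ring

theorem IsLinearlyDifferenceClosed.exists_isSignedFrame [IsAlgClosed F] [NeZero (2 : F)]
    (hφ : IsLinearlyDifferenceClosed φ) {n : ℕ} (A : orthogonalGroup (Fin n) F) :
    ∃ (s : Finset (Fin n)) (z : Fin n → Fin n → F),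
      IsSignedFrame (semilinearMulVec (φ : F →+* F) A.1) s z := by
  have hA := (mem_orthogonalGroup_iff _ _).1 A.2
  obtain ⟨W, hW⟩ := hφ n ⟨A.1ᵀ, A.1, (mem_orthogonalGroup_iff' _ _).1 A.2, hA⟩
  have hW' : W.1.map φ = A.1ᵀ * W.1 := congrArg Units.val hW
  refine _root_.exists_isSignedFrame A.2 (W := W) ?_
  exact (congrArg _ hW').trans (by rw [← Matrix.mul_assoc, hA, Matrix.one_mul])

theorem IsLinearlyDifferenceClosed.twistedConj_signDiagonal [IsAlgClosed F] [NeZero (2 : F)]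
    (hφ : IsLinearlyDifferenceClosed φ) {I : F} (hI : I * I = -1) (hφI : φ I = I) {n : ℕ}
    (A : orthogonalGroup (Fin n) F) (o : Fin n) :
    twistedConjSetoid (orthogonalGroupAut n φ) A (signDiagonal F ∅) ∨
      twistedConjSetoid (orthogonalGroupAut n φ) A (signDiagonal F {o}) := by
  obtain ⟨u, hu, hφu⟩ := hφ.exists_map_eq_neg
  obtain ⟨p, q, hpq, hp, hq⟩ :=
    exists_mul_self_add_mul_self_eq_one_of_map_eq_neg (σ := (φ : F →+* F)) hu hφu hI hφI
  obtain ⟨s, z, hz⟩ := hφ.exists_isSignedFrame A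
  obtain ⟨s', z', hz', hs'⟩ := hz.exists_card_le_one hpq hp hq
  rcases Nat.le_one_iff_eq_zero_or_eq_one.1 hs' with h | h
  · rw [Finset.card_eq_zero] at h
    exact .inl (h ▸ hz').twistedConj
  · obtain ⟨i, rfl⟩ := Finset.card_eq_one.1 h
    exact .inr (hz'.singleton_swap o).twistedConj

theorem IsLinearlyDifferenceClosed.reidemeisterNumber_eq_two [IsAlgClosed F] [NeZero (2 : F)]
    (hφ : IsLinearlyDifferenceClosed φ) {I : F} (hI : I * I = -1) (hφI : φ I = I) {n : ℕ}
    (hn : 1 ≤ n) : reidemeisterNumber (orthogonalGroupAut n φ) = 2 := by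
  refine _root_.reidemeisterNumber_eq_two (a := signDiagonal F ∅) (b := signDiagonal F {⟨0, hn⟩})
    (fun h => ?_) fun A => hφ.twistedConj_signDiagonal hI hφI A _
  have hdet := det_eq_of_twistedConj h
  rw [det_signDiagonal, det_signDiagonal, Finset.card_empty, Finset.card_singleton, pow_zero,
    pow_one, eq_neg_iff_add_eq_zero, one_add_one_eq_two] at hdet
  exact two_ne_zero hdet

end LinearlyDifferenceClosed

theorem theorem3_general {k F : Type*} [Field k] [Countable k] [Field F] [NeZero (2 : F)]
    [Algebra k F] [IsAlgClosed F] (hF : Cardinal.aleph0 ≤ Algebra.trdeg k F) :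
    ∃ φ : F ≃+* F, ∀ n, 1 ≤ n → reidemeisterNumber (orthogonalGroupAut n φ) = 2 := by
  obtain ⟨φ, hφ, hfix⟩ := exists_isLinearlyDifferenceClosed hF
  obtain ⟨I, hI⟩ := IsAlgClosed.exists_eq_mul_self (-1 : F)
  have hI_alg : IsAlgebraic k I :=
    IsAlgebraic.of_pow two_pos (by rw [sq, ← hI]; exact isAlgebraic_one.neg)
  exact ⟨φ, fun n hn => hφ.reidemeisterNumber_eq_two hI.symm (hfix I hI_alg) hn⟩

theorem theorem3 {F : Type*} [Field F] [IsAlgClosed F] [CharZero F]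
    (hF : Cardinal.aleph0 ≤ Algebra.trdeg ℚ F) (n : ℕ) (hn : 1 ≤ n) :
    ∃ φ : F ≃+* F, reidemeisterNumber (orthogonalGroupAut n φ) = 2 :=
  (theorem3_general hF).imp fun _ h => h n hn
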